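/- Let $k,T\ge 1$, let $P$ be a row-stochastic $k\times k$ matrix, and suppose that all $T$ step kernels equal $P$, so that the end-to-end kernel is $Q=P^T$. Let $\pi$ be a stationary law of $P$ with $\pi_{\min}:=\min_i\pi_i>0$, and let $P^*_{ij}:=\pi_jP_{ji}/\pi_i$ be the time reversal of $P$. Assume that the pseudo-spectral gap $\gamma:=\max_{m\ge1}\frac1m\,\mathrm{gap}\big((P^*)^mP^m\big)$ is positive, where $\mathrm{gap}(A):=1-\sup\{|\lambda|:\lambda\in\mathrm{spec}(A),\ \lambda\ne1\}$ if the eigenvalue $1$ of $A$ is simple, and $\mathrm{gap}(A):=0$ otherwise. Let $\mu$ be an input law with $\min_i\mu_i>0$, and put $\chi_0:=\big(\sum_i(\mu_i-\pi_i)^2/\pi_i\big)^{1/2}$. Assume that there are $\Delta_P>0$ and a map $I:[k]\to[k]$ with $P_{i,I(i)}-P_{ij}\ge\Delta_P$ for all $i$ and all $j\ne I(i)$ (per-row margin), and that $I^{\circ T}(i)$ attains $\max_jQ_{ij}$ for every $i$ (local-global argmax consistency). Finally, let $$r:=1-\frac{\chi_0}{T\pi_{\min}\gamma}>0,\qquad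 0<\delta<1 .$$ We observe $n$ independent full paths $(X^{(\ell)}_0,\dots,X^{(\ell)}_T)$, $1\le\ell\le n$, each a Markov chain with initial law $\mu$ and kernel $P$. Let $N_{ij}$ be the number of transitions from $i$ to $j$, pooled over all steps and all paths. Count-and-argmax picks for each $i$ some $\hat h(i)\in\arg\max_jN_{ij}$ (ties broken arbitrarily), and chain-of-thought inference predicts $\hat j^*(i):=\hat h^{\circ T}(i)$. Then there is a constant $C_\gamma>0$ depending only on $\gamma$ such that, whenever $$n\ \ge\ C_\gamma\left(\frac1{T\pi_{\min}\Delta_P^2\,r}+\frac1{T\pi_{\min}^2r^2}\right)\log\frac k\delta ,$$ with probability at least $1-\delta$ we have $\hat j^*(i)\in\arg\max_jQ_{ij}$ for all $i$ simultaneously, however ties are broken. With the dependence on $\gamma$ made explicit, there is an absolute constant $C>0$ such that the same conclusion holds whenever $$n\ \ge\ C\left(\frac1{T\pi_{\min}\Delta_P^2\,r}+\frac1{\gamma\,T\pi_{\min}^2r^2}\right)\log\frac k\delta .$$ -/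

import Mathlib

open MeasureTheory ProbabilityTheory

noncomputable section

/-- The smallest entry of a vector. -/
def minEntry {k : ℕ} (v : Fin k → ℝ) : ℝ := ⨅ i, v i

/-- `j` is a maximal index of the vector `v`. -/
def IsArgmax {k : ℕ} {R : Type*} [LE R] (v : Fin k → R) (j : Fin k) : Prop :=
  ∀ l, v l ≤ v j

/-- The chi-square divergence of `ν` from `π`. -/
def chiSq {k : ℕ} (ν π : Fin k → ℝ) : ℝ := ∑ i, (ν i - π i) ^ 2 / π i

/-- The time reversal of the kernel `P` with respect to `π`, that is, its adjoint on `L²(π)`. -/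
def timeReversal {k : ℕ} (π : Fin k → ℝ) (P : Matrix (Fin k) (Fin k) ℝ) :
    Matrix (Fin k) (Fin k) ℝ :=
  Matrix.of fun i j => π j * P j i / π i

open Classical in
/-- The absolute spectral gap of a Markov kernel `A` that is self-adjoint on `L²(π)`:
`1 - sup {|z| : z ∈ spec A, z ≠ 1}` if the eigenvalue `1` is simple, and `0` otherwise. -/
def spectralGap {k : ℕ} (A : Matrix (Fin k) (Fin k) ℝ) : ℝ :=
  if Module.finrank ℝ (Module.End.eigenspace (Matrix.toLin' A) 1) = 1 then
    1 - sSup {x : ℝ | ∃ z ∈ spectrum ℝ A, z ≠ 1 ∧ x = |z|}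
  else 0

/-- The pseudo-spectral gap `max_{m ≥ 1} γ((P*)^m P^m) / m` of a kernel `P` with stationary
law `π`. -/
def pseudoSpectralGap {k : ℕ} (π : Fin k → ℝ) (P : Matrix (Fin k) (Fin k) ℝ) : ℝ :=
  ⨆ m : {m : ℕ // 1 ≤ m}, spectralGap (timeReversal π P ^ m.1 * P ^ m.1) / (m.1 : ℝ)

/-- The assumptions on a homogeneous chain-of-thought instance with `T` steps on `k` states. -/
structure HomogeneousInstance {k : ℕ} (T : ℕ) (P : Matrix (Fin k) (Fin k) ℝ)
    (μ π : Fin k → ℝ) (Δ : ℝ) (I : Fin k → Fin k) : Prop where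
  /-- `P` is a transition kernel. -/
  kernel : P ∈ Matrix.rowStochastic ℝ (Fin k)
  /-- `μ` is a probability vector. -/
  input : μ ∈ stdSimplex ℝ (Fin k)
  /-- The input law charges every state. -/
  input_pos : 0 < minEntry μ
  /-- `π` is a probability vector. -/
  law : π ∈ stdSimplex ℝ (Fin k)
  /-- `π` is stationary for `P`. -/
  stationary : Matrix.vecMul π P = π
  /-- `π` charges every state. -/
  law_pos : 0 < minEntry π
  /-- The pseudo-spectral gap is positive. -/
  gap_pos : 0 < pseudoSpectralGap π P
  /-- The margin is positive. -/
  margin_pos : 0 < Δ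
  /-- `I i` is the (unique) maximal index of row `i`, with margin at least `Δ`. -/
  margin : ∀ i j, j ≠ I i → Δ ≤ P i (I i) - P i j
  /-- Local-global consistency: the `T`-fold composition of the local argmax is the argmax of the
  end-to-end kernel. -/
  consistent : ∀ i, IsArgmax ((P ^ T) i) (I^[T] i)

/-- `X ℓ t` is the state at time `t` of the `ℓ`-th context trajectory: the `n` full paths are
independent Markov chains with initial law `μ` and kernel `P`, observed at times `0, …, T`. -/
structure IsContextSample {Ω : Type*} [MeasurableSpace Ω] (Pr : Measure Ω) {k n T : ℕ}
    (μ : Fin k → ℝ) (P : Matrix (Fin k) (Fin k) ℝ)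
    (X : Fin n → Fin (T + 1) → Ω → Fin k) : Prop where
  measurable : ∀ ℓ t, Measurable (X ℓ t)
  indep : iIndepFun (fun (ℓ : Fin n) (ω : Ω) (t : Fin (T + 1)) => X ℓ t ω) Pr
  path_law : ∀ (ℓ : Fin n) (x : Fin (T + 1) → Fin k),
    Pr {ω | ∀ t, X ℓ t ω = x t} =
      ENNReal.ofReal (μ (x 0) * ∏ t : Fin T, P (x t.castSucc) (x t.succ))

/-- The number of observed transitions from `i` to `j`, pooled over all steps and trajectories. -/
def transitionCount {k n T : ℕ} (x : Fin n → Fin (T + 1) → Fin k) (i j : Fin k) : ℕ :=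
  (Finset.univ.filter fun p : Fin n × Fin T =>
    x p.1 p.2.castSucc = i ∧ x p.1 p.2.succ = j).card

/-- Chain-of-thought inference is correct on the data `x`: however ties are broken, the row-wise
argmax of the pooled counts, composed along the `T` steps, sends every input `i` to the argmax
of the `i`-th row of `Q`. -/
def CoTCorrect {k n T : ℕ} (Q : Matrix (Fin k) (Fin k) ℝ)
    (x : Fin n → Fin (T + 1) → Fin k) : Prop :=
  ∀ h : Fin k → Fin k, (∀ i, IsArgmax (transitionCount x i) (h i)) →
    ∀ i, IsArgmax (Q i) (h^[T] i)

/-- The factor `r = 1 - χ₀ / (T π_min γ)`, where `χ₀² = χ²(μ ‖ π)`. -/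
def coverageFactor {k : ℕ} (T : ℕ) (P : Matrix (Fin k) (Fin k) ℝ) (μ π : Fin k → ℝ) : ℝ :=
  1 - √(chiSq μ π) / (T * minEntry π * pseudoSpectralGap π P)

end

/-!
The prediction is correct as soon as in every row `i` the count `N i (I i)` strictly exceeds all
other counts: then the empirical argmax is `I` however ties are broken, and the consistency
assumption applies. So it suffices that, with high probability, each state is visited often and,
given enough visits, the counts in its row are in the right order. Both follow from exponential
Markov inequalities for weights that are products over the observed transitions. By independence
the mean of such a weight is an `n`-th power, and for a single path it is the mass that `T` steps
of a reweighted kernel transport (`measureReal_le_of_transition_weight`).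

*Order of the counts.* Rewarding each visit to `i` by `exp (Δ ^ 2 / 4)` and weighting the
transitions to `j` and to `I i` by `exp (± Δ / 2)` gives a substochastic kernel. Hence a wrong order
after `s` visits has probability at most `exp (- s Δ ^ 2 / 4)` (`measureReal_wrong_order_le`).

*Number of visits.* Here the mass leaving `i` is damped by the factor `1 - ε`. Split a measure `u`
into a multiple of `π` and a deviation of mass zero. If the pseudo-spectral gap `γ` is attained at
`m`, then `P ^ m` contracts deviations by `1 - m γ / 2` in the chi-square norm
(`chiNorm_vecMul_pow_le`), so that a suitable average of the norms of `v, v P, …, v P ^ (m - 1)` is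
contracted by each single step. The potential `mass + ε b ‖deviation‖` then shrinks by the factor
`1 - ε π i + 4 ε ^ 2 π i / γ` per step (`potential_step`), with `b ≤ 1 / γ + 8 ε / γ ^ 2`. The
initial deviation thus costs `ε χ₀ / γ` up to second order, which is `ε (1 - r) T π_min`, and the
mean weight of a path is at most `exp (T π i (- ε r + 12 ε ^ 2 / γ))`. Taking `ε` proportional to
`γ r`, fewer than half of the `n T π i r` expected visits occur with probability at most
`exp (- n T π i γ r ^ 2 / 208)` (`measureReal_visitCount_le`).

A union bound over the pairs of states concludes.
-/

noncomputable section

/-- The norm of a signed measure `v` on the states, `(∑ i, v i ^ 2 / π i) ^ (1 / 2)`. It is the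
`L²(π)` norm of the density `v / π`, and `chiSq μ π` is the square of `chiNorm π (μ - π)`. It is
the Euclidean norm of the rescaled vector `v / √π`, which makes the triangle and Cauchy-Schwarz
inequalities available. -/
def chiNorm {k : ℕ} (π v : Fin k → ℝ) : ℝ := ‖WithLp.toLp 2 (fun i => v i / √(π i))‖

/-! ### The chi-square norm -/

section ChiNorm
variable {k : ℕ} {π : Fin k → ℝ}

theorem chiNorm_nonneg (v : Fin k → ℝ) : 0 ≤ chiNorm π v := norm_nonneg _

theorem chiNorm_sq (hπ : ∀ i, 0 < π i) (v : Fin k → ℝ) :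
    chiNorm π v ^ 2 = ∑ i, v i ^ 2 / π i := by
  rw [chiNorm, EuclideanSpace.norm_sq_eq]
  refine Finset.sum_congr rfl fun i _ => ?_
  rw [Real.norm_eq_abs, sq_abs, div_pow, Real.sq_sqrt (hπ i).le]

theorem chiNorm_add_le (v w : Fin k → ℝ) : chiNorm π (v + w) ≤ chiNorm π v + chiNorm π w := by
  refine le_trans (le_of_eq ?_) (norm_add_le _ _)
  rw [chiNorm, ← WithLp.toLp_add]
  congr 2
  ext i
  simp [add_div]

theorem chiNorm_smul (c : ℝ) (v : Fin k → ℝ) : chiNorm π (c • v) = |c| * chiNorm π v := by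
  rw [chiNorm, chiNorm, ← Real.norm_eq_abs, ← norm_smul, ← WithLp.toLp_smul]
  congr 2
  ext i
  simp [mul_div_assoc]

theorem abs_sum_mul_div_le (hπ : ∀ i, 0 < π i) (v w : Fin k → ℝ) :
    |∑ i, v i * w i / π i| ≤ chiNorm π v * chiNorm π w := by
  refine le_trans (le_of_eq ?_) (abs_real_inner_le_norm
    (WithLp.toLp 2 (fun i => v i / √(π i))) (WithLp.toLp 2 (fun i => w i / √(π i))))
  congr 1
  rw [PiLp.inner_apply]
  refine Finset.sum_congr rfl fun i _ => ?_
  have : √(π i) ≠ 0 := (Real.sqrt_pos.2 (hπ i)).ne'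
  have h2 := Real.sq_sqrt (hπ i).le
  simp only [RCLike.inner_apply, conj_trivial]
  rw [div_mul_div_comm, ← sq, h2, mul_comm]

/-- A kernel does not increase the chi-square distance to its stationary law. -/
theorem chiNorm_vecMul_le (hπ : ∀ i, 0 < π i) {P : Matrix (Fin k) (Fin k) ℝ}
    (hP : P ∈ Matrix.rowStochastic ℝ (Fin k)) (hs : Matrix.vecMul π P = π) (v : Fin k → ℝ) :
    chiNorm π (Matrix.vecMul v P) ≤ chiNorm π v := by
  rw [Matrix.mem_rowStochastic_iff_sum] at hP
  refine (sq_le_sq₀ (chiNorm_nonneg _) (chiNorm_nonneg _)).1 ?_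
  rw [chiNorm_sq hπ, chiNorm_sq hπ]
  have key : ∀ j, Matrix.vecMul v P j ^ 2 / π j ≤ ∑ i, v i ^ 2 / π i * P i j := by
    intro j
    rw [div_le_iff₀ (hπ j)]
    have hj : π j = ∑ i, π i * P i j := by
      conv_lhs => rw [← hs]
      rfl
    have hcs := Finset.sum_sq_le_sum_mul_sum_of_sq_le_mul Finset.univ (r := fun i => v i * P i j)
      (f := fun i => v i ^ 2 / π i * P i j) (g := fun i => π i * P i j)
      (fun i _ => mul_nonneg (div_nonneg (sq_nonneg _) (hπ i).le) (hP.1 i j))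
      (fun i _ => mul_nonneg (hπ i).le (hP.1 i j))
      (fun i _ => le_of_eq (by field_simp [(hπ i).ne']))
    rw [← hj] at hcs
    exact hcs
  calc _ ≤ ∑ j, ∑ i, v i ^ 2 / π i * P i j := Finset.sum_le_sum fun j _ => key j
    _ = _ := by
      rw [Finset.sum_comm]
      refine Finset.sum_congr rfl fun i _ => ?_
      rw [← Finset.mul_sum, hP.2 i, mul_one]

/-- The signed measure `δ_i - π`, of total mass zero. -/
def centered (π : Fin k → ℝ) (i : Fin k) : Fin k → ℝ := Pi.single i 1 - π

theorem chiNorm_centered_sq (hπ : ∀ i, 0 < π i) (h1 : ∑ i, π i = 1) (i : Fin k) :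
    (π i * chiNorm π (centered π i)) ^ 2 = π i * (1 - π i) := by
  rw [mul_pow, chiNorm_sq hπ]
  have : ∀ j, centered π i j ^ 2 / π j
      = (Pi.single i (1 / π i - 2) : Fin k → ℝ) j + π j := by
    intro j
    have := (hπ j).ne'
    by_cases h : j = i
    · subst h
      simp only [centered, Pi.sub_apply, Pi.single_eq_same]
      field_simp
      ring
    · simp only [centered, Pi.sub_apply, Pi.single_eq_of_ne h]
      field_simp
      ring
  have h0 := (hπ i).ne'
  rw [Finset.sum_congr rfl fun j _ => this j, Finset.sum_add_distrib, h1,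
    Finset.sum_pi_single']
  simp only [Finset.mem_univ, if_true]
  field_simp
  ring

/-- For a measure of mass zero, pairing with the function `1_i - π i` instead of `1_i` gains the
factor `√(1 - π i)` contained in `chiNorm π (centered π i)`. -/
theorem abs_apply_le_of_sum_eq_zero (hπ : ∀ i, 0 < π i) {v : Fin k → ℝ} (hv : ∑ i, v i = 0)
    (i : Fin k) : |v i| ≤ π i * chiNorm π (centered π i) * chiNorm π v := by
  have h := abs_sum_mul_div_le hπ (centered π i) v
  have h0 := (hπ i).ne'
  have : ∑ j, centered π i j * v j / π j = v i / π i := by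
    have : ∀ j, centered π i j * v j / π j = (Pi.single i (v i / π i) : Fin k → ℝ) j - v j := by
      intro j
      have := (hπ j).ne'
      by_cases h : j = i
      · subst h
        simp only [centered, Pi.sub_apply, Pi.single_eq_same]
        field_simp
      · simp only [centered, Pi.sub_apply, Pi.single_eq_of_ne h]
        field_simp
        ring
    rw [Finset.sum_congr rfl fun j _ => this j, Finset.sum_sub_distrib, hv,
      Finset.sum_pi_single']
    simp
  rw [this, abs_div, abs_of_pos (hπ i), div_le_iff₀ (hπ i)] at h
  linarith [h, mul_comm (chiNorm π (centered π i) * chiNorm π v) (π i)]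

end ChiNorm

/-! ### The spectral gap and the time reversal -/

section Gap
variable {k : ℕ} {π : Fin k → ℝ} {A : Matrix (Fin k) (Fin k) ℝ}

theorem spectralGap_le_one (A : Matrix (Fin k) (Fin k) ℝ) : spectralGap A ≤ 1 := by
  rw [spectralGap]
  split_ifs
  · have : 0 ≤ sSup {x : ℝ | ∃ z ∈ spectrum ℝ A, z ≠ 1 ∧ x = |z|} := by
      refine Real.sSup_nonneg ?_
      rintro x ⟨z, -, -, rfl⟩
      exact abs_nonneg z
    linarith
  · exact zero_le_one

theorem mem_spectrum_of_mulVec_eq {f : Fin k → ℝ} (hf : f ≠ 0) {c : ℝ}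
    (h : A.mulVec f = c • f) : c ∈ spectrum ℝ A := by
  rw [← Matrix.spectrum_toLin', ← Module.End.hasEigenvalue_iff_mem_spectrum]
  exact Module.End.hasEigenvalue_of_hasEigenvector (x := f)
    ⟨Module.End.mem_eigenspace_iff.2 (by simpa using h), hf⟩

theorem eigenvalue_le_one_sub_spectralGap (hgap : 0 < spectralGap A) {f : Fin k → ℝ} (hf : f ≠ 0)
    {c : ℝ} (hc : c ≠ 1) (h : A.mulVec f = c • f) : c ≤ 1 - spectralGap A := by
  rw [spectralGap] at hgap ⊢
  split_ifs at hgap ⊢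
  · rw [sub_sub_cancel]
    refine (le_abs_self c).trans (le_csSup ?_ ⟨c, mem_spectrum_of_mulVec_eq hf h, hc, rfl⟩)
    refine Set.Finite.bddAbove (Set.Finite.subset ((Matrix.finite_spectrum A).image abs) ?_)
    rintro x ⟨z, hz, -, rfl⟩
    exact ⟨z, hz, rfl⟩
  · exact absurd hgap (lt_irrefl _)

/-- A positive gap makes the eigenvalue `1` simple, so that only constants are invariant. -/
theorem exists_eq_const_of_mulVec_eq (hgap : 0 < spectralGap A) (hA : A.mulVec 1 = 1)
    (hk : k ≠ 0)
    {f : Fin k → ℝ} (h : A.mulVec f = f) : ∃ c : ℝ, f = c • (1 : Fin k → ℝ) := by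
  rw [spectralGap] at hgap
  split_ifs at hgap with h1
  · have hone : (1 : Fin k → ℝ) ∈ Module.End.eigenspace (Matrix.toLin' A) 1 :=
      Module.End.mem_eigenspace_iff.2 (by simpa using hA)
    have hff : f ∈ Module.End.eigenspace (Matrix.toLin' A) 1 :=
      Module.End.mem_eigenspace_iff.2 (by simpa using h)
    have hne : (⟨1, hone⟩ : Module.End.eigenspace (Matrix.toLin' A) 1) ≠ 0 := by
      intro h0
      have := congrFun (congrArg Subtype.val h0) ⟨0, Nat.pos_of_ne_zero hk⟩
      simp at this
    obtain ⟨c, hc⟩ := (finrank_eq_one_iff_of_nonzero' _ hne).1 h1 ⟨f, hff⟩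
    exact ⟨c, (congrArg Subtype.val hc).symm⟩
  · exact absurd hgap (lt_irrefl _)

/-- The time reversal of `P` is its adjoint on `L²(π)`, and so are the powers. -/
theorem diagonal_mul_timeReversal_pow (hπ : ∀ i, 0 < π i) (P : Matrix (Fin k) (Fin k) ℝ) (m : ℕ) :
    Matrix.diagonal π * timeReversal π P ^ m = (P ^ m).transpose * Matrix.diagonal π := by
  have h1 : Matrix.diagonal π * timeReversal π P = P.transpose * Matrix.diagonal π := by
    ext i j
    rw [Matrix.diagonal_mul, Matrix.mul_diagonal, timeReversal, Matrix.of_apply,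
      Matrix.transpose_apply]
    field_simp [(hπ i).ne']
  have := SemiconjBy.pow_right (a := Matrix.diagonal π) (x := timeReversal π P)
    (y := P.transpose) h1 m
  rw [Matrix.transpose_pow]
  exact this

end Gap

/-! ### Contraction of `P ^ m` in the chi-square norm -/

section Contraction
variable {k : ℕ} {π : Fin k → ℝ} {P : Matrix (Fin k) (Fin k) ℝ}

theorem vecMul_pow_of_stationary (hs : Matrix.vecMul π P = π) (m : ℕ) :
    Matrix.vecMul π (P ^ m) = π := by
  induction m with
  | zero => simp
  | succ m ih => rw [pow_succ, ← Matrix.vecMul_vecMul, ih, hs]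

theorem timeReversal_pow_mul_mulVec_one (hπ : ∀ i, 0 < π i)
    (hP : P ∈ Matrix.rowStochastic ℝ (Fin k)) (hs : Matrix.vecMul π P = π) (m : ℕ) :
    (timeReversal π P ^ m * P ^ m).mulVec 1 = 1 := by
  have h1 : (P ^ m).mulVec 1 = 1 := Matrix.one_vecMul_of_mem_rowStochastic (pow_mem hP m)
  have h2 : (Matrix.diagonal π).mulVec ((timeReversal π P ^ m).mulVec 1) = π := by
    rw [Matrix.mulVec_mulVec, diagonal_mul_timeReversal_pow hπ, ← Matrix.mulVec_mulVec,
      Matrix.mulVec_transpose]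
    have : (Matrix.diagonal π).mulVec 1 = π := by
      ext i
      simp [Matrix.mulVec_diagonal]
    rw [this, vecMul_pow_of_stationary hs]
  rw [← Matrix.mulVec_mulVec, h1]
  ext i
  have := congrFun h2 i
  rw [Matrix.mulVec_diagonal] at this
  exact mul_left_cancel₀ (hπ i).ne' (by simpa using this)

/-- Poincaré inequality: `‖P ^ m h‖² ≤ (1 - gap) ‖h‖²` in `L²(π)` for `h` of mean zero. The matrix
`(P*) ^ m P ^ m` is conjugate, by `diag √π`, to a symmetric one, whose orthonormal eigenbasis
diagonalizes the quadratic form `‖P ^ m h‖²`. -/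
theorem sum_mul_sq_mulVec_pow_le (hπ : ∀ i, 0 < π i)
    (hP : P ∈ Matrix.rowStochastic ℝ (Fin k)) (hs : Matrix.vecMul π P = π) {m : ℕ}
    (hgap : 0 < spectralGap (timeReversal π P ^ m * P ^ m)) {h : Fin k → ℝ}
    (hh : ∑ i, π i * h i = 0) :
    ∑ i, π i * ((P ^ m).mulVec h i) ^ 2
      ≤ (1 - spectralGap (timeReversal π P ^ m * P ^ m)) * ∑ i, π i * h i ^ 2 := by
  rcases Nat.eq_zero_or_pos k with rfl | hk
  · simp
  set A := timeReversal π P ^ m * P ^ m with hA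
  have hsq : ∀ i, √(π i) * √(π i) = π i := fun i => Real.mul_self_sqrt (hπ i).le
  have hs0 : ∀ i, √(π i) ≠ 0 := fun i => (Real.sqrt_pos.2 (hπ i)).ne'
  let B : Matrix (Fin k) (Fin k) ℝ := Matrix.of fun i j => √(π i) * (P ^ m) i j / √(π j)
  let S : Matrix (Fin k) (Fin k) ℝ := B.transpose * B
  have hS : S.IsHermitian := by
    have := Matrix.isHermitian_conjTranspose_mul_self B
    rwa [Matrix.conjTranspose_eq_transpose_of_trivial] at this
  have hSA : ∀ i j, S i j = √(π i) * A i j / √(π j) := by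
    intro i j
    have h1 : π i * A i j = ∑ l, (P ^ m) l i * π l * (P ^ m) l j := by
      have : (Matrix.diagonal π * A) i j
          = ((P ^ m).transpose * Matrix.diagonal π * P ^ m) i j := by
        rw [hA, ← Matrix.mul_assoc, diagonal_mul_timeReversal_pow hπ]
      rw [Matrix.diagonal_mul, Matrix.mul_apply] at this
      simpa only [Matrix.mul_diagonal, Matrix.transpose_apply] using this
    have h2 : S i j = (∑ l, (P ^ m) l i * π l * (P ^ m) l j) / (√(π i) * √(π j)) := by
      change (B.transpose * B) i j = _
      rw [Matrix.mul_apply, Finset.sum_div]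
      refine Finset.sum_congr rfl fun l _ => ?_
      simp only [Matrix.transpose_apply, B, Matrix.of_apply]
      rw [div_mul_div_comm]
      congr 1
      linear_combination ((P ^ m) l i * (P ^ m) l j) * hsq l
    rw [h2, ← h1, div_eq_div_iff (mul_ne_zero (hs0 i) (hs0 j)) (hs0 j)]
    linear_combination -(A i j * √(π j)) * hsq i
  let x : EuclideanSpace ℝ (Fin k) := WithLp.toLp 2 fun i => √(π i) * h i
  let y : EuclideanSpace ℝ (Fin k) := WithLp.toLp 2 (S.mulVec x)
  let b := hS.eigenvectorBasis
  have hev : ∀ l, S.mulVec (b l) = hS.eigenvalues l • (b l : Fin k → ℝ) :=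
    hS.mulVec_eigenvectorBasis
  -- an eigenvector of `S` is `√π` times an eigenvector of `A`
  have hAf : ∀ l, A.mulVec (fun i => b l i / √(π i))
      = hS.eigenvalues l • (fun i => b l i / √(π i)) := by
    intro l
    ext i
    have h1 := congrFun (hev l) i
    simp only [Matrix.mulVec, dotProduct, Pi.smul_apply, smul_eq_mul] at h1 ⊢
    rw [← mul_div_assoc, ← h1, Finset.sum_div]
    refine Finset.sum_congr rfl fun j _ => ?_
    rw [hSA]
    field_simp [hs0 i, hs0 j]
  have hfne : ∀ l, (fun i => b l i / √(π i)) ≠ 0 := by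
    intro l h0
    apply b.orthonormal.ne_zero l
    ext i
    have := congrFun h0 i
    simpa [hs0 i] using this
  have hinner : ∀ l, inner ℝ (b l) y = hS.eigenvalues l * inner ℝ (b l) x := by
    intro l
    have h1 : inner ℝ (b l) y = dotProduct (b l : Fin k → ℝ) (S.mulVec x) := by
      simp [y, PiLp.inner_apply, dotProduct, mul_comm]
    have h2 : inner ℝ (b l) x = dotProduct (b l : Fin k → ℝ) x := by
      simp [PiLp.inner_apply, dotProduct, mul_comm]
    have h3 : S.transpose = S := by simp [S, Matrix.transpose_mul]
    rw [h1, h2, Matrix.dotProduct_mulVec, ← Matrix.mulVec_transpose, h3, hev, smul_dotProduct,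
      smul_eq_mul]
  have hterm : ∀ l, inner ℝ x (b l) * inner ℝ (b l) y
      ≤ (1 - spectralGap A) * (inner ℝ x (b l) * inner ℝ (b l) x) := by
    intro l
    rw [hinner, real_inner_comm (b l) x]
    have hsqr : 0 ≤ inner ℝ (b l) x * inner ℝ (b l) x := mul_self_nonneg _
    by_cases hc : hS.eigenvalues l = 1
    · -- the eigenvalue `1` is simple, so that this eigenvector is `√π`, which is orthogonal to `x`
      have h1 := hAf l
      rw [hc, one_smul] at h1
      obtain ⟨c, hcf⟩ := exists_eq_const_of_mulVec_eq hgap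
        (timeReversal_pow_mul_mulVec_one hπ hP hs m) hk.ne' h1
      have h0 : inner ℝ (b l) x = 0 := by
        have : inner ℝ (b l) x = c * ∑ i, π i * h i := by
          rw [PiLp.inner_apply, Finset.mul_sum]
          refine Finset.sum_congr rfl fun i _ => ?_
          have h2 := congrFun hcf i
          simp only [Pi.smul_apply, Pi.one_apply, smul_eq_mul, mul_one] at h2
          rw [div_eq_iff (hs0 i)] at h2
          simp only [RCLike.inner_apply, conj_trivial, x]
          rw [h2]
          linear_combination (c * h i) * hsq i
        rw [this, hh, mul_zero]
      rw [h0]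
      simp
    · have := eigenvalue_le_one_sub_spectralGap hgap (hfne l) hc (hAf l)
      nlinarith
  have h1 : ∑ i, π i * ((P ^ m).mulVec h i) ^ 2 = inner ℝ x y := by
    have hB : ∀ i, B.mulVec x i = √(π i) * (P ^ m).mulVec h i := by
      intro i
      simp only [Matrix.mulVec, dotProduct, B, Matrix.of_apply, x]
      rw [Finset.mul_sum]
      refine Finset.sum_congr rfl fun j _ => ?_
      field_simp [hs0 j]
    have : inner ℝ x y = dotProduct (x : Fin k → ℝ) (S.mulVec x) := by
      simp [y, PiLp.inner_apply, dotProduct, mul_comm]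
    rw [this, ← Matrix.mulVec_mulVec, Matrix.dotProduct_mulVec, Matrix.vecMul_transpose]
    simp only [dotProduct, hB]
    refine Finset.sum_congr rfl fun i _ => ?_
    linear_combination -((P ^ m).mulVec h i ^ 2) * hsq i
  have h2 : ∑ i, π i * h i ^ 2 = inner ℝ x x := by
    rw [PiLp.inner_apply]
    refine Finset.sum_congr rfl fun i _ => ?_
    simp only [RCLike.inner_apply, conj_trivial, x]
    linear_combination -(h i ^ 2) * hsq i
  rw [h1, h2, ← b.sum_inner_mul_inner x y, ← b.sum_inner_mul_inner x x, Finset.mul_sum]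
  exact Finset.sum_le_sum fun l _ => hterm l

theorem sum_vecMul_eq (hP : P ∈ Matrix.rowStochastic ℝ (Fin k)) (v : Fin k → ℝ) :
    ∑ i, Matrix.vecMul v P i = ∑ i, v i := by
  have := Matrix.one_vecMul_of_mem_rowStochastic hP
  have h2 := Matrix.dotProduct_mulVec v P 1
  rw [this] at h2
  simpa [dotProduct] using h2.symm

/-- On measures of mass zero `P ^ m` contracts the chi-square norm. On densities it acts as
`(P*) ^ m`, whose norm on the mean-zero functions is that of its adjoint `P ^ m`. -/
theorem chiNorm_vecMul_pow_le (hπ : ∀ i, 0 < π i)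
    (hP : P ∈ Matrix.rowStochastic ℝ (Fin k)) (hs : Matrix.vecMul π P = π) {m : ℕ}
    (hgap : 0 < spectralGap (timeReversal π P ^ m * P ^ m)) {v : Fin k → ℝ}
    (hv : ∑ i, v i = 0) :
    chiNorm π (Matrix.vecMul v (P ^ m))
      ≤ (1 - spectralGap (timeReversal π P ^ m * P ^ m) / 2) * chiNorm π v := by
  set g := spectralGap (timeReversal π P ^ m * P ^ m) with hg
  have hg1 : g ≤ 1 := spectralGap_le_one _
  set w := Matrix.vecMul v (P ^ m) with hw
  let h : Fin k → ℝ := fun i => w i / π i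
  have hπh : ∀ i, π i * h i = w i := fun i => mul_div_cancel₀ _ (hπ i).ne'
  have h0 : ∑ i, π i * h i = 0 := by
    simp only [hπh]
    rw [hw, sum_vecMul_eq (pow_mem hP m), hv]
  have h1 := sum_mul_sq_mulVec_pow_le hπ hP hs hgap h0
  have h2 : ∑ i, π i * h i ^ 2 = chiNorm π w ^ 2 := by
    rw [chiNorm_sq hπ]
    refine Finset.sum_congr rfl fun i _ => ?_
    simp only [h]
    field_simp [(hπ i).ne']
  have h3 : ∑ i, π i * ((P ^ m).mulVec h i) ^ 2
      = chiNorm π (fun i => π i * (P ^ m).mulVec h i) ^ 2 := by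
    rw [chiNorm_sq hπ]
    refine Finset.sum_congr rfl fun i _ => ?_
    field_simp [(hπ i).ne']
  -- `‖w‖² = ⟨v, P ^ m h⟩`, by moving one factor `P ^ m` across the inner product
  have h4 : chiNorm π w ^ 2 ≤ chiNorm π v * chiNorm π (fun i => π i * (P ^ m).mulVec h i) := by
    refine le_trans (le_of_eq ?_) ((le_abs_self _).trans (abs_sum_mul_div_le hπ v _))
    rw [chiNorm_sq hπ]
    have h5 : ∑ i, w i ^ 2 / π i = dotProduct w h := by
      refine Finset.sum_congr rfl fun i _ => ?_
      simp only [h]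
      ring
    rw [h5, hw, ← Matrix.dotProduct_mulVec]
    refine Finset.sum_congr rfl fun i _ => ?_
    field_simp [(hπ i).ne']
  rw [h2, h3, ← hg] at h1
  set z := chiNorm π (fun i => π i * (P ^ m).mulVec h i)
  have hw0 : 0 ≤ chiNorm π w := chiNorm_nonneg _
  have hv0 : 0 ≤ chiNorm π v := chiNorm_nonneg _
  have hz : z ≤ (1 - g / 2) * chiNorm π w := by
    refine abs_le_of_sq_le_sq' ?_ (mul_nonneg (by linarith) hw0) |>.2
    nlinarith [sq_nonneg (g * chiNorm π w)]
  by_contra hlt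
  push Not at hlt
  have hwpos : 0 < chiNorm π w := lt_of_le_of_lt (mul_nonneg (by linarith) hv0) hlt
  nlinarith [mul_le_mul_of_nonneg_left hz hv0]

/-- The supremum that defines the pseudo-spectral gap is attained if it is positive. -/
theorem exists_spectralGap_eq (hgap : 0 < pseudoSpectralGap π P) :
    ∃ m : ℕ, 1 ≤ m ∧
      spectralGap (timeReversal π P ^ m * P ^ m) = m * pseudoSpectralGap π P := by
  set γ := pseudoSpectralGap π P with hγ
  let F : ℕ → ℝ := fun m => spectralGap (timeReversal π P ^ m * P ^ m) / (m : ℝ)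
  have hle : ∀ m, 1 ≤ m → F m ≤ 1 / m := fun m hm =>
    div_le_div_of_nonneg_right (spectralGap_le_one _) (Nat.cast_nonneg m)
  have hbdd : BddAbove (Set.range fun m : {m : ℕ // 1 ≤ m} => F m.1) := by
    refine ⟨1, ?_⟩
    rintro _ ⟨m, rfl⟩
    refine (hle m.1 m.2).trans ?_
    rw [div_le_one (by exact_mod_cast m.2)]
    exact_mod_cast m.2
  have : Nonempty {m : ℕ // 1 ≤ m} := ⟨⟨1, le_rfl⟩⟩
  -- only the `m ≤ 2 / γ` matter, as the `m`-th term is at most `1 / m`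
  let N := Finset.Icc 1 (⌊2 / γ⌋₊ + 1)
  obtain ⟨m, hm, hmax⟩ := Finset.exists_max_image N F ⟨1, by simp [N]⟩
  have hm1 : 1 ≤ m := (Finset.mem_Icc.1 hm).1
  refine ⟨m, hm1, ?_⟩
  have hm0 : (m : ℝ) ≠ 0 := by positivity
  have hsup : γ ≤ max (F m) (γ / 2) := by
    rw [hγ]
    refine ciSup_le fun l => ?_
    by_cases hl : l.1 ∈ N
    · exact le_max_of_le_left (hmax _ hl)
    · refine le_max_of_le_right ((hle _ l.2).trans ?_)
      have h1 : ⌊2 / γ⌋₊ + 1 < l.1 := by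
        by_contra h
        exact hl (Finset.mem_Icc.2 ⟨l.2, not_lt.1 h⟩)
      have h2 : 2 / γ < l.1 := (Nat.lt_floor_add_one _).trans (by exact_mod_cast h1)
      rw [div_lt_iff₀ hgap] at h2
      rw [div_le_div_iff₀ (by exact_mod_cast l.2) two_pos]
      linarith
  have h1 : F m ≤ γ := le_ciSup hbdd ⟨m, hm1⟩
  have h2 : γ ≤ F m := by
    rcases le_max_iff.1 hsup with h | h
    · exact h
    · linarith
  have h3 : F m = γ := le_antisymm h1 h2
  rw [← h3]
  exact (mul_div_cancel₀ _ hm0).symm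

end Contraction

/-! ### A norm adapted to an `m`-step contraction -/

section AveragedNorm
variable {k : ℕ} {π : Fin k → ℝ} {P : Matrix (Fin k) (Fin k) ℝ}

/-- The average of `q ^ (m - 1 - j) ‖v P ^ j‖` over `j < m`. If `P ^ m` contracts the chi-square
norm, then already one step of `P` contracts this norm (`averagedNorm_vecMul_add_le`), while it
stays below the chi-square norm itself. -/
def averagedNorm (π : Fin k → ℝ) (P : Matrix (Fin k) (Fin k) ℝ) (q : ℝ) (m : ℕ)
    (v : Fin k → ℝ) : ℝ :=
  (∑ j ∈ Finset.range m, q ^ (m - 1 - j) * chiNorm π (Matrix.vecMul v (P ^ j))) / m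

theorem averagedNorm_le_chiNorm (hπ : ∀ i, 0 < π i) (hP : P ∈ Matrix.rowStochastic ℝ (Fin k))
    (hs : Matrix.vecMul π P = π) {q : ℝ} (hq0 : 0 ≤ q) (hq1 : q ≤ 1) (m : ℕ) (v : Fin k → ℝ) :
    averagedNorm π P q m v ≤ chiNorm π v := by
  rw [averagedNorm]
  refine div_le_of_le_mul₀ (Nat.cast_nonneg m) (chiNorm_nonneg v) ?_
  refine (Finset.sum_le_card_nsmul _ _ (chiNorm π v) fun j _ => ?_).trans (le_of_eq ?_)
  · have h1 := chiNorm_vecMul_le hπ (pow_mem hP j) (vecMul_pow_of_stationary hs j) v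
    have h2 := pow_le_one₀ (n := m - 1 - j) hq0 hq1
    have h3 : 0 ≤ q ^ (m - 1 - j) := pow_nonneg hq0 _
    have h4 : 0 ≤ chiNorm π (Matrix.vecMul v (P ^ j)) := chiNorm_nonneg _
    nlinarith
  · rw [Finset.card_range, nsmul_eq_mul, mul_comm]

theorem averagedNorm_sub_smul_le {q c : ℝ} (hq0 : 0 ≤ q) (hc : 0 ≤ c) (m : ℕ) (v w : Fin k → ℝ) :
    averagedNorm π P q m (v - c • w) ≤ averagedNorm π P q m v + c * averagedNorm π P q m w := by
  rw [averagedNorm, averagedNorm, averagedNorm, ← mul_div_assoc, ← add_div, Finset.mul_sum,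
    ← Finset.sum_add_distrib]
  refine div_le_div_of_nonneg_right (Finset.sum_le_sum fun j _ => ?_) (Nat.cast_nonneg m)
  have h : chiNorm π (Matrix.vecMul (v - c • w) (P ^ j))
      ≤ chiNorm π (Matrix.vecMul v (P ^ j)) + c * chiNorm π (Matrix.vecMul w (P ^ j)) := by
    have h1 : Matrix.vecMul (v - c • w) (P ^ j)
        = Matrix.vecMul v (P ^ j) + (-c) • Matrix.vecMul w (P ^ j) := by
      rw [Matrix.sub_vecMul, Matrix.smul_vecMul, neg_smul, sub_eq_add_neg]
    rw [h1]
    refine (chiNorm_add_le _ _).trans (le_of_eq ?_)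
    rw [chiNorm_smul, abs_neg, abs_of_nonneg hc]
  have h3 : 0 ≤ q ^ (m - 1 - j) := pow_nonneg hq0 _
  nlinarith

/-- One step of `P` shrinks the averaged norm. The sum telescopes, leaving the difference
`((1 - s) ^ m - (1 - m γ / 2)) / m` of the two end terms, which is at least `γ / 2 - s`. -/
theorem averagedNorm_vecMul_add_le (hπ : ∀ i, 0 < π i)
    (hP : P ∈ Matrix.rowStochastic ℝ (Fin k)) (hs : Matrix.vecMul π P = π) {m : ℕ} (hm : 1 ≤ m)
    {γ s : ℝ} (hγ : 0 < γ) (hgap : spectralGap (timeReversal π P ^ m * P ^ m) = m * γ)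
    (hs1 : s ≤ 1) {v : Fin k → ℝ} (hv : ∑ i, v i = 0) :
    averagedNorm π P (1 - s) m (Matrix.vecMul v P) + (γ / 2 - s) * chiNorm π v
      ≤ (1 - s) * averagedNorm π P (1 - s) m v := by
  have hm0 : (0 : ℝ) < m := by exact_mod_cast hm
  let c : ℕ → ℝ := fun j => (1 - s) ^ (m - j) * chiNorm π (Matrix.vecMul v (P ^ j))
  have h1 : averagedNorm π P (1 - s) m (Matrix.vecMul v P)
      = (∑ j ∈ Finset.range m, c (j + 1)) / m := by
    rw [averagedNorm]
    congr 1
    refine Finset.sum_congr rfl fun j _ => ?_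
    simp only [c]
    rw [Matrix.vecMul_vecMul, ← pow_succ', Nat.sub_sub, add_comm 1 j]
  have h2 : (1 - s) * averagedNorm π P (1 - s) m v = (∑ j ∈ Finset.range m, c j) / m := by
    rw [averagedNorm, ← mul_div_assoc, Finset.mul_sum]
    congr 1
    refine Finset.sum_congr rfl fun j hj => ?_
    simp only [c]
    rw [← mul_assoc, ← pow_succ']
    congr 2
    have := Finset.mem_range.1 hj
    omega
  have h3 : (∑ j ∈ Finset.range m, c (j + 1)) - ∑ j ∈ Finset.range m, c j = c m - c 0 := by
    rw [← Finset.sum_sub_distrib, Finset.sum_range_sub]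
  have hcm : c m ≤ (1 - m * γ / 2) * chiNorm π v := by
    have := chiNorm_vecMul_pow_le hπ hP hs (m := m) (by rw [hgap]; positivity) hv
    rw [hgap] at this
    simpa [c] using this
  have hc0 : (1 - m * s) * chiNorm π v ≤ c 0 := by
    have := one_add_mul_le_pow (a := -s) (by linarith) m
    simp only [c, Nat.sub_zero, pow_zero, Matrix.vecMul_one]
    refine mul_le_mul_of_nonneg_right ?_ (chiNorm_nonneg v)
    rw [sub_eq_add_neg 1 s]
    linarith
  rw [h1, h2, ← sub_nonneg]
  have : (∑ j ∈ Finset.range m, c j) / m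
      - ((∑ j ∈ Finset.range m, c (j + 1)) / m + (γ / 2 - s) * chiNorm π v)
      = (c 0 - c m - m * (γ / 2 - s) * chiNorm π v) / m := by
    rw [show c 0 - c m = (∑ j ∈ Finset.range m, c j) - ∑ j ∈ Finset.range m, c (j + 1) by
      linarith]
    field_simp
    ring
  rw [this]
  refine div_nonneg ?_ hm0.le
  nlinarith

end AveragedNorm

/-! ### The mass transported by the damped kernel -/

section Damped
variable {k : ℕ} {π : Fin k → ℝ} {P : Matrix (Fin k) (Fin k) ℝ}

/-- The kernel `P` with the mass leaving the state `i` multiplied by `1 - ε`. The mass that its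
powers transport is the mean of `(1 - ε)` to the number of visits to `i`. -/
def damped (P : Matrix (Fin k) (Fin k) ℝ) (ε : ℝ) (i : Fin k) : Matrix (Fin k) (Fin k) ℝ :=
  Matrix.of fun a b => (if a = i then 1 - ε else 1) * P a b

theorem vecMul_damped (u : Fin k → ℝ) (ε : ℝ) (i : Fin k) :
    Matrix.vecMul u (damped P ε i) = Matrix.vecMul (u - (ε * u i) • Pi.single i 1) P := by
  ext b
  simp only [Matrix.vecMul, dotProduct, damped, Matrix.of_apply]
  refine Finset.sum_congr rfl fun a _ => ?_
  by_cases h : a = i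
  · subst h
    simp
    ring
  · simp [h]

/-- The part of `u` of mass zero: `u` minus the multiple of `π` of the same mass. -/
def deviation (π u : Fin k → ℝ) : Fin k → ℝ := u - (∑ j, u j) • π

theorem sum_deviation (h1 : ∑ i, π i = 1) (u : Fin k → ℝ) : ∑ i, deviation π u i = 0 := by
  simp only [deviation, Pi.sub_apply, Pi.smul_apply, smul_eq_mul, Finset.sum_sub_distrib,
    ← Finset.mul_sum, h1, mul_one, sub_self]

theorem sum_vecMul_damped (hP : P ∈ Matrix.rowStochastic ℝ (Fin k)) (u : Fin k → ℝ) (ε : ℝ)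
    (i : Fin k) : ∑ b, Matrix.vecMul u (damped P ε i) b = ∑ b, u b - ε * u i := by
  rw [vecMul_damped, sum_vecMul_eq hP]
  simp only [Pi.sub_apply, Pi.smul_apply, smul_eq_mul, Finset.sum_sub_distrib, ← Finset.mul_sum,
    Finset.sum_pi_single', Finset.mem_univ, if_true, mul_one]

theorem deviation_vecMul_damped (hP : P ∈ Matrix.rowStochastic ℝ (Fin k))
    (hs : Matrix.vecMul π P = π) (u : Fin k → ℝ) (ε : ℝ) (i : Fin k) :
    deviation π (Matrix.vecMul u (damped P ε i))
      = Matrix.vecMul (deviation π u) P - (ε * u i) • Matrix.vecMul (centered π i) P := by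
  rw [deviation, sum_vecMul_damped hP, vecMul_damped, deviation, centered, Matrix.sub_vecMul,
    Matrix.sub_vecMul, Matrix.sub_vecMul, Matrix.smul_vecMul, Matrix.smul_vecMul, hs, smul_sub,
    sub_smul]
  abel

/-- One step of the damped chain multiplies the potential `mass + ε b ‖deviation‖` by at most
`1 - ε π i + 4 ε² π i / γ`. Damping moves the mass by the value of the deviation at `i` and
creates a deviation proportional to `ε`; the weight `b`, about `2 √(π i (1 - π i)) / γ`, is chosen
so that the decay of the deviation pays for both. -/
theorem potential_step (hπ : ∀ i, 0 < π i) (h1 : ∑ i, π i = 1)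
    (hP : P ∈ Matrix.rowStochastic ℝ (Fin k)) (hs : Matrix.vecMul π P = π) {m : ℕ} (hm : 1 ≤ m)
    {γ ε : ℝ} (hγ : 0 < γ) (hgap : spectralGap (timeReversal π P ^ m * P ^ m) = m * γ)
    (hε : 0 < ε) (hεγ : ε ≤ γ / 16) (i : Fin k) {b : ℝ}
    (hb : b = π i * chiNorm π (centered π i) * (1 + 4 * ε / γ) / (γ / 2 - ε))
    {u : Fin k → ℝ} (hu : ∀ j, 0 ≤ u j) :
    ∑ j, Matrix.vecMul u (damped P ε i) j + ε * b * averagedNorm π P (1 - ε * π i) m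
        (deviation π (Matrix.vecMul u (damped P ε i)))
      ≤ (1 - ε * π i + 4 * ε ^ 2 * π i / γ) *
        (∑ j, u j + ε * b * averagedNorm π P (1 - ε * π i) m (deviation π u)) := by
  have hγ1 : γ ≤ 1 := by
    have h2 : (m : ℝ) * γ ≤ 1 := hgap ▸ spectralGap_le_one _
    have h3 : (1 : ℝ) ≤ m := by exact_mod_cast hm
    nlinarith
  have hπi := hπ i
  have hπ1 : π i ≤ 1 := h1 ▸ Finset.single_le_sum (fun j _ => (hπ j).le) (Finset.mem_univ i)
  have hεπ : ε * π i ≤ ε := by nlinarith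
  set q := 1 - ε * π i with hq
  have hq0 : 0 ≤ q := by linarith
  have hq1 : q ≤ 1 := by
    have := mul_pos hε hπi
    linarith
  set v := deviation π u with hv
  set a := ∑ j, u j with ha
  set κ := π i * chiNorm π (centered π i) with hκ
  have hv0 : ∑ j, v j = 0 := sum_deviation h1 u
  have ha0 : 0 ≤ a := Finset.sum_nonneg fun j _ => hu j
  have hx0 : 0 ≤ chiNorm π v := chiNorm_nonneg v
  have hκ0 : 0 ≤ κ := mul_nonneg hπi.le (chiNorm_nonneg _)
  have hκ2 : κ ^ 2 ≤ π i := by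
    rw [hκ, chiNorm_centered_sq hπ h1]
    nlinarith
  have hui : u i = a * π i + v i := by
    simp only [hv, deviation, Pi.sub_apply, Pi.smul_apply, smul_eq_mul]
    ring
  have hvi := abs_le.1 (abs_apply_le_of_sum_eq_zero hπ hv0 i)
  rw [← hκ] at hvi
  have hb0 : 0 ≤ b := by
    rw [hb]
    have : 0 < γ / 2 - ε := by linarith
    positivity
  have hbx : b * (γ / 2 - ε) = κ * (1 + 4 * ε / γ) := by
    rw [hb, div_mul_cancel₀]
    linarith
  have hbκ : b * κ ≤ 4 * π i / γ := by
    have h2 : b * κ * (γ / 2 - ε) = κ ^ 2 * (1 + 4 * ε / γ) := by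
      rw [mul_right_comm, hbx]
      ring
    have h3 : 4 * ε / γ ≤ 1 / 4 := by
      rw [div_le_iff₀ hγ]
      linarith
    have h4 : κ ^ 2 * (1 + 4 * ε / γ) ≤ π i * (5 / 4) :=
      mul_le_mul hκ2 (by linarith) (by positivity) hπi.le
    rw [le_div_iff₀ hγ]
    have h5 : b * κ * (7 / 16 * γ) ≤ b * κ * (γ / 2 - ε) :=
      mul_le_mul_of_nonneg_left (by linarith) (mul_nonneg hb0 hκ0)
    nlinarith
  have hchi : chiNorm π (centered π i) = κ / π i := by
    rw [hκ]
    field_simp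
  have hcent : averagedNorm π P q m (Matrix.vecMul (centered π i) P) ≤ κ / π i := by
    rw [← hchi]
    exact (averagedNorm_le_chiNorm hπ hP hs hq0 hq1 m _).trans (chiNorm_vecMul_le hπ hP hs _)
  have hstep := averagedNorm_vecMul_add_le hπ hP hs hm hγ hgap (s := ε * π i) (by linarith) hv0
  rw [← hq] at hstep
  have hdev : averagedNorm π P q m (deviation π (Matrix.vecMul u (damped P ε i)))
      ≤ q * averagedNorm π P q m v - (γ / 2 - ε) * chiNorm π v
        + ε * (a * π i + κ * chiNorm π v) * (κ / π i) := by
    rw [deviation_vecMul_damped hP hs]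
    have h2 := averagedNorm_sub_smul_le (π := π) (P := P) hq0
      (mul_nonneg hε.le (hu i)) m (Matrix.vecMul v P) (Matrix.vecMul (centered π i) P)
    have h3 : ε * u i * averagedNorm π P q m (Matrix.vecMul (centered π i) P)
        ≤ ε * (a * π i + κ * chiNorm π v) * (κ / π i) := by
      refine mul_le_mul ?_ hcent ?_ ?_
      · exact mul_le_mul_of_nonneg_left (by linarith [hvi.2]) hε.le
      · rw [averagedNorm]
        exact div_nonneg (Finset.sum_nonneg fun j _ =>
          mul_nonneg (pow_nonneg hq0 _) (chiNorm_nonneg _)) (Nat.cast_nonneg m)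
      · positivity
    have h4 : (γ / 2 - ε) * chiNorm π v ≤ (γ / 2 - ε * π i) * chiNorm π v :=
      mul_le_mul_of_nonneg_right (by linarith) hx0
    linarith
  rw [sum_vecMul_damped hP]
  set L := averagedNorm π P q m v with hL
  have hL0 : 0 ≤ L := div_nonneg (Finset.sum_nonneg fun j _ =>
          mul_nonneg (pow_nonneg hq0 _) (chiNorm_nonneg _)) (Nat.cast_nonneg m)
  set x := chiNorm π v
  have hmass : a - ε * u i ≤ a * q + ε * κ * x := by
    rw [hui, hq]
    have := mul_le_mul_of_nonneg_left hvi.1 hε.le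
    linarith
  have hmul := mul_le_mul_of_nonneg_left hdev (mul_nonneg hε.le hb0)
  have hexp : ε * b * (q * L - (γ / 2 - ε) * x + ε * (a * π i + κ * x) * (κ / π i))
      = ε * b * q * L - ε * x * (κ * (1 + 4 * ε / γ)) + ε ^ 2 * a * (b * κ)
        + ε ^ 2 * κ * x * (b * κ / π i) := by
    rw [← hbx]
    field_simp
    ring
  have h5 : ε ^ 2 * a * (b * κ) ≤ ε ^ 2 * a * (4 * π i / γ) :=
    mul_le_mul_of_nonneg_left hbκ (by positivity)
  have h6 : ε ^ 2 * κ * x * (b * κ / π i) ≤ ε ^ 2 * κ * x * (4 / γ) := by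
    refine mul_le_mul_of_nonneg_left ?_ (by positivity)
    rw [div_le_iff₀ hπi]
    exact hbκ.trans (le_of_eq (by ring))
  have h7 : 0 ≤ (4 * ε ^ 2 * π i / γ) * (ε * b * L) := by positivity
  have h8 : ε * x * (κ * (1 + 4 * ε / γ)) = ε * κ * x + ε ^ 2 * κ * x * (4 / γ) := by ring
  have h9 : (q + 4 * ε ^ 2 * π i / γ) * (a + ε * b * L)
      = a * q + ε ^ 2 * a * (4 * π i / γ) + ε * b * q * L
        + (4 * ε ^ 2 * π i / γ) * (ε * b * L) := by ring
  rw [h9]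
  linarith

theorem vecMul_damped_pow_nonneg (hP : P ∈ Matrix.rowStochastic ℝ (Fin k)) {ε : ℝ} (hε : ε ≤ 1)
    (i : Fin k) {μ : Fin k → ℝ} (hμ : ∀ j, 0 ≤ μ j) (T : ℕ) (j : Fin k) :
    0 ≤ Matrix.vecMul μ (damped P ε i ^ T) j := by
  induction T generalizing j with
  | zero => simpa using hμ j
  | succ T ih =>
    rw [pow_succ, ← Matrix.vecMul_vecMul]
    change 0 ≤ ∑ a, Matrix.vecMul μ (damped P ε i ^ T) a * damped P ε i a j
    refine Finset.sum_nonneg fun a _ => mul_nonneg (ih a) ?_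
    rw [damped, Matrix.of_apply]
    refine mul_nonneg ?_ (Matrix.nonneg_of_mem_rowStochastic hP)
    split_ifs
    · linarith
    · exact zero_le_one

/-- The mass transported in `T` damped steps. The constant `1 / γ` in front of the initial distance
to `π` comes from `2 √(π i (1 - π i)) ≤ 1`. -/
theorem sum_vecMul_damped_pow_le (hπ : ∀ i, 0 < π i) (h1 : ∑ i, π i = 1)
    (hP : P ∈ Matrix.rowStochastic ℝ (Fin k)) (hs : Matrix.vecMul π P = π) {m : ℕ} (hm : 1 ≤ m)
    {γ ε : ℝ} (hγ : 0 < γ) (hgap : spectralGap (timeReversal π P ^ m * P ^ m) = m * γ)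
    (hε : 0 < ε) (hεγ : ε ≤ γ / 16) (i : Fin k) {μ : Fin k → ℝ} (hμ : ∀ j, 0 ≤ μ j)
    (hμ1 : ∑ j, μ j = 1) (T : ℕ) :
    ∑ j, Matrix.vecMul μ (damped P ε i ^ T) j
      ≤ Real.exp (T * (-(ε * π i) + 4 * ε ^ 2 * π i / γ)
          + ε * (1 / γ + 8 * ε / γ ^ 2) * chiNorm π (μ - π)) := by
  have hγ1 : γ ≤ 1 := by
    have h2 : (m : ℝ) * γ ≤ 1 := hgap ▸ spectralGap_le_one _
    have h3 : (1 : ℝ) ≤ m := by exact_mod_cast hm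
    nlinarith
  have hπi := hπ i
  have hπ1 : π i ≤ 1 := h1 ▸ Finset.single_le_sum (fun j _ => (hπ j).le) (Finset.mem_univ i)
  have hεπ : ε * π i ≤ ε := by nlinarith
  set κ := π i * chiNorm π (centered π i) with hκ
  have hκ0 : 0 ≤ κ := mul_nonneg hπi.le (chiNorm_nonneg _)
  have hκ2 : κ ≤ 1 / 2 := by
    have : κ ^ 2 = π i * (1 - π i) := chiNorm_centered_sq hπ h1 i
    nlinarith [sq_nonneg (π i - 1 / 2)]
  let b := κ * (1 + 4 * ε / γ) / (γ / 2 - ε)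
  have hd : 0 < γ / 2 - ε := by linarith
  have hb0 : 0 ≤ b := by
    have : 0 ≤ 1 + 4 * ε / γ := by positivity
    exact div_nonneg (mul_nonneg hκ0 this) hd.le
  have hb1 : b ≤ 1 / γ + 8 * ε / γ ^ 2 := by
    rw [div_le_iff₀ hd]
    have h3 : (1 / γ + 8 * ε / γ ^ 2) * (γ / 2 - ε)
        = 1 / 2 * (1 + 4 * ε / γ) + (ε / γ) * (1 - 8 * (ε / γ)) := by
      field_simp
      ring
    have h4 : ε / γ ≤ 1 / 16 := by
      rw [div_le_iff₀ hγ]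
      linarith
    have h5 : 0 ≤ (ε / γ) * (1 - 8 * (ε / γ)) :=
      mul_nonneg (by positivity) (by linarith)
    have h6 : κ * (1 + 4 * ε / γ) ≤ 1 / 2 * (1 + 4 * ε / γ) :=
      mul_le_mul_of_nonneg_right hκ2 (by positivity)
    linarith
  set q := 1 - ε * π i with hq
  have hq0 : 0 ≤ q := by linarith
  have hq1 : q ≤ 1 := by
    have := mul_pos hε hπi
    linarith
  let Φ : (Fin k → ℝ) → ℝ := fun u => ∑ j, u j + ε * b * averagedNorm π P q m (deviation π u)
  set Q := 1 - ε * π i + 4 * ε ^ 2 * π i / γ with hQ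
  have hQ0 : 0 ≤ Q := add_nonneg hq0 (by positivity)
  have hnn : ∀ v, 0 ≤ averagedNorm π P q m v := fun v =>
    div_nonneg (Finset.sum_nonneg fun j _ =>
      mul_nonneg (pow_nonneg hq0 _) (chiNorm_nonneg _)) (Nat.cast_nonneg m)
  have hiter : ∀ t : ℕ, Φ (Matrix.vecMul μ (damped P ε i ^ t)) ≤ Q ^ t * Φ μ := by
    intro t
    induction t with
    | zero => simp
    | succ t ih =>
      rw [pow_succ, ← Matrix.vecMul_vecMul]
      calc Φ _ ≤ Q * Φ (Matrix.vecMul μ (damped P ε i ^ t)) :=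
            potential_step hπ h1 hP hs hm hγ hgap hε hεγ i rfl
              (vecMul_damped_pow_nonneg hP (by linarith) i hμ t)
        _ ≤ Q * (Q ^ t * Φ μ) := mul_le_mul_of_nonneg_left ih hQ0
        _ = Q ^ (t + 1) * Φ μ := by ring
  have h0 : Φ μ ≤ Real.exp (ε * (1 / γ + 8 * ε / γ ^ 2) * chiNorm π (μ - π)) := by
    have hdev : deviation π μ = μ - π := by rw [deviation, hμ1, one_smul]
    have h3 : ε * b * averagedNorm π P q m (μ - π)
        ≤ ε * (1 / γ + 8 * ε / γ ^ 2) * chiNorm π (μ - π) :=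
      mul_le_mul (mul_le_mul_of_nonneg_left hb1 hε.le)
        (averagedNorm_le_chiNorm hπ hP hs hq0 hq1 m _) (hnn _) (by positivity)
    have := Real.add_one_le_exp (ε * (1 / γ + 8 * ε / γ ^ 2) * chiNorm π (μ - π))
    simp only [Φ, hdev, hμ1]
    linarith
  have hQe : Q ^ T ≤ Real.exp (T * (-(ε * π i) + 4 * ε ^ 2 * π i / γ)) := by
    rw [Real.exp_nat_mul]
    refine pow_le_pow_left₀ hQ0 ?_ T
    have := Real.add_one_le_exp (-(ε * π i) + 4 * ε ^ 2 * π i / γ)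
    linarith
  calc ∑ j, Matrix.vecMul μ (damped P ε i ^ T) j
      ≤ Φ (Matrix.vecMul μ (damped P ε i ^ T)) :=
        le_add_of_nonneg_right (mul_nonneg (mul_nonneg hε.le hb0) (hnn _))
    _ ≤ Q ^ T * Φ μ := hiter T
    _ ≤ _ := by
      rw [Real.exp_add]
      refine mul_le_mul hQe h0 ?_ (Real.exp_nonneg _)
      exact add_nonneg (by rw [hμ1]; exact zero_le_one)
        (mul_nonneg (mul_nonneg hε.le hb0) (hnn _))

end Damped

/-! ### Sums over paths -/

section Paths
variable {k : ℕ}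

/-- The total weight of all paths, for weights that are products over the transitions. -/
theorem sum_path_weight (W : Matrix (Fin k) (Fin k) ℝ) (T : ℕ) (μ : Fin k → ℝ) :
    ∑ x : Fin (T + 1) → Fin k, μ (x 0) * ∏ t : Fin T, W (x t.castSucc) (x t.succ)
      = ∑ j, Matrix.vecMul μ (W ^ T) j := by
  induction T generalizing μ with
  | zero =>
    simp only [Finset.univ_eq_empty, Finset.prod_empty, mul_one, pow_zero, Matrix.vecMul_one]
    exact Fintype.sum_equiv (Equiv.funUnique (Fin 1) (Fin k)) _ _ fun x => rfl
  | succ T ih =>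
    rw [pow_succ', ← Matrix.vecMul_vecMul, ← ih,
      ← (Fin.consEquiv fun _ : Fin (T + 2) => Fin k).sum_comp, Fintype.sum_prod_type_right]
    refine Finset.sum_congr rfl fun x _ => ?_
    rw [Matrix.vecMul, dotProduct, Finset.sum_mul]
    refine Finset.sum_congr rfl fun a _ => ?_
    rw [Fin.prod_univ_succ]
    simp only [Fin.consEquiv_apply, Fin.cons_zero, Fin.castSucc_zero, Fin.cons_succ,
      ← Fin.succ_castSucc]
    ring

end Paths

/-! ### Exponential Markov inequality for the sample -/

section Sample
variable {Ω : Type*} [MeasurableSpace Ω] {Pr : Measure Ω} {k n T : ℕ} {μ : Fin k → ℝ}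
  {P : Matrix (Fin k) (Fin k) ℝ} {X : Fin n → Fin (T + 1) → Ω → Fin k}

theorem integral_comp_path [IsFiniteMeasure Pr] (hX : IsContextSample Pr μ P X)
    (hP : P ∈ Matrix.rowStochastic ℝ (Fin k)) (hμ : ∀ j, 0 ≤ μ j) (ℓ : Fin n)
    (F : (Fin (T + 1) → Fin k) → ℝ) :
    ∫ ω, F (fun t => X ℓ t ω) ∂Pr
      = ∑ x : Fin (T + 1) → Fin k,
          (μ (x 0) * ∏ t : Fin T, P (x t.castSucc) (x t.succ)) * F x := by
  have hZ : Measurable fun ω (t : Fin (T + 1)) => X ℓ t ω :=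
    measurable_pi_iff.2 fun t => hX.measurable ℓ t
  have hF : Measurable F := measurable_of_finite F
  rw [← integral_map (f := F) hZ.aemeasurable hF.aestronglyMeasurable,
    integral_fintype .of_finite]
  refine Finset.sum_congr rfl fun x _ => ?_
  rw [smul_eq_mul, measureReal_def, Measure.map_apply hZ (measurableSet_singleton x)]
  congr 1
  have : (fun ω (t : Fin (T + 1)) => X ℓ t ω) ⁻¹' {x} = {ω | ∀ t, X ℓ t ω = x t} := by
    ext ω
    simp [funext_iff]
  rw [this, hX.path_law, ENNReal.toReal_ofReal]
  exact mul_nonneg (hμ _) (Finset.prod_nonneg fun t _ => Matrix.nonneg_of_mem_rowStochastic hP)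

/-- Exponential Markov inequality for a weight that is a product over all observed transitions:
its expectation is a power of the mass that the reweighted kernel transports. -/
theorem measureReal_le_of_transition_weight [IsProbabilityMeasure Pr]
    (hX : IsContextSample Pr μ P X)
    (hP : P ∈ Matrix.rowStochastic ℝ (Fin k)) (hμ : ∀ j, 0 ≤ μ j)
    {f : Fin k → Fin k → ℝ} (hf : ∀ a b, 0 ≤ f a b) {c : ℝ} (hc : 0 ≤ c) {E : Set Ω}
    (hE : ∀ ω ∈ E, 1 ≤ c * ∏ p : Fin n × Fin T, f (X p.1 p.2.castSucc ω) (X p.1 p.2.succ ω)) :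
    Pr.real E
      ≤ c * (∑ j, Matrix.vecMul μ ((Matrix.of fun a b => f a b * P a b) ^ T) j) ^ n := by
  let F : (Fin (T + 1) → Fin k) → ℝ := fun x => ∏ t : Fin T, f (x t.castSucc) (x t.succ)
  let D : Ω → Fin n → Fin (T + 1) → Fin k := fun ω ℓ t => X ℓ t ω
  have hD : Measurable D :=
    measurable_pi_iff.2 fun ℓ => measurable_pi_iff.2 fun t => hX.measurable ℓ t
  have hmean : ∀ ℓ : Fin n, ∫ ω, F (fun t => X ℓ t ω) ∂Pr
      = ∑ j, Matrix.vecMul μ ((Matrix.of fun a b => f a b * P a b) ^ T) j := by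
    intro ℓ
    rw [integral_comp_path hX hP hμ, ← sum_path_weight]
    refine Finset.sum_congr rfl fun x _ => ?_
    simp only [F, Matrix.of_apply, Finset.prod_mul_distrib]
    ring
  have hprod : ∫ ω, ∏ ℓ, F (fun t => X ℓ t ω) ∂Pr
      = (∑ j, Matrix.vecMul μ ((Matrix.of fun a b => f a b * P a b) ^ T) j) ^ n := by
    have hind := hX.indep.integral_fun_prod_comp (f := fun _ => F)
      (fun ℓ => (measurable_pi_iff.2 fun t => hX.measurable ℓ t).aemeasurable)
      (fun ℓ => (measurable_of_finite F).aestronglyMeasurable)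
    rw [hind, Finset.prod_congr rfl fun ℓ _ => hmean ℓ, Finset.prod_const, Finset.card_univ,
      Fintype.card_fin]
  let G : (Fin n → Fin (T + 1) → Fin k) → ℝ := fun x => c * ∏ ℓ, F (x ℓ)
  have hGpos : ∀ x, 0 ≤ G x := fun x => mul_nonneg hc
    (Finset.prod_nonneg fun ℓ _ => Finset.prod_nonneg fun t _ => hf _ _)
  have hGint : Integrable (fun ω => G (D ω)) Pr := by
    refine Integrable.of_bound ((measurable_of_finite G).comp hD).aestronglyMeasurable
      (∑ x, ‖G x‖) (.of_forall fun ω => ?_)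
    exact Finset.single_le_sum (f := fun x => ‖G x‖) (fun x _ => norm_nonneg _)
      (Finset.mem_univ (D ω))
  calc Pr.real E ≤ Pr.real {ω | 1 ≤ G (D ω)} := by
        refine measureReal_mono fun ω hω => ?_
        have := hE ω hω
        rw [Fintype.prod_prod_type] at this
        exact this
    _ ≤ ∫ ω, G (D ω) ∂Pr := by
        have := mul_meas_ge_le_integral_of_nonneg (μ := Pr) (.of_forall fun ω => hGpos (D ω))
          hGint 1
        rwa [one_mul] at this
    _ = _ := by
        rw [← hprod, ← integral_const_mul]

end Sample

/-! ### Visit counts and the tilted kernel -/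

section Counts
variable {k n T : ℕ}

/-- The number of visits to `i` from which a transition is observed, that is, at times before `T`,
pooled over all trajectories. -/
def visitCount (x : Fin n → Fin (T + 1) → Fin k) (i : Fin k) : ℕ :=
  (Finset.univ.filter fun p : Fin n × Fin T => x p.1 p.2.castSucc = i).card

theorem prod_damping (x : Fin n → Fin (T + 1) → Fin k) (i : Fin k) (c : ℝ) :
    ∏ p : Fin n × Fin T, (if x p.1 p.2.castSucc = i then c else 1) = c ^ visitCount x i := by
  rw [Finset.prod_ite, Finset.prod_const, Finset.prod_const_one, mul_one, visitCount]

/-- The exponent of the tilted kernel: it rewards a visit to `i` by `Δ ^ 2 / 4` and compares the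
transitions from `i` to `j` with those from `i` to `l`. -/
def tilt (Δ : ℝ) (i j l a b : Fin k) : ℝ :=
  Δ ^ 2 / 4 * (if a = i then 1 else 0)
    + Δ / 2 * ((if a = i ∧ b = j then 1 else 0) - (if a = i ∧ b = l then 1 else 0))

theorem prod_exp_tilt (x : Fin n → Fin (T + 1) → Fin k) (Δ : ℝ) (i j l : Fin k) :
    ∏ p : Fin n × Fin T, Real.exp (tilt Δ i j l (x p.1 p.2.castSucc) (x p.1 p.2.succ))
      = Real.exp (Δ ^ 2 / 4 * visitCount x i
          + Δ / 2 * ((transitionCount x i j : ℝ) - transitionCount x i l)) := by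
  rw [← Real.exp_sum]
  congr 1
  simp only [tilt, Finset.sum_add_distrib, ← Finset.mul_sum, Finset.sum_sub_distrib,
    Finset.sum_boole, visitCount, transitionCount]

theorem sum_vecMul_pow_le {W : Matrix (Fin k) (Fin k) ℝ} (hW : ∀ a b, 0 ≤ W a b)
    (hW1 : ∀ a, ∑ b, W a b ≤ 1) {μ : Fin k → ℝ} (hμ : ∀ j, 0 ≤ μ j) (t : ℕ) :
    ∑ j, Matrix.vecMul μ (W ^ t) j ≤ ∑ j, μ j := by
  induction t generalizing μ with
  | zero => simp
  | succ t ih =>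
    rw [pow_succ', ← Matrix.vecMul_vecMul]
    have hnn : ∀ j, 0 ≤ Matrix.vecMul μ W j := by
      intro j
      change 0 ≤ ∑ a, μ a * W a j
      exact Finset.sum_nonneg fun a _ => mul_nonneg (hμ a) (hW a j)
    refine (ih hnn).trans ?_
    change ∑ j, ∑ a, μ a * W a j ≤ _
    rw [Finset.sum_comm]
    refine Finset.sum_le_sum fun a _ => ?_
    rw [← Finset.mul_sum]
    exact mul_le_of_le_one_right (hμ a) (hW1 a)

/-- The tilted kernel is substochastic. By `exp y ≤ 1 + y + y ^ 2` the comparison of `j` with `l`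
lowers the mean over the row `i` to `1 - Δ ^ 2 / 4`, which compensates the reward of a visit. -/
theorem sum_exp_tilt_mul_le_one {P : Matrix (Fin k) (Fin k) ℝ}
    (hP : P ∈ Matrix.rowStochastic ℝ (Fin k)) {Δ : ℝ} (hΔ : 0 < Δ) {i j l : Fin k} (hjl : j ≠ l)
    (hmargin : Δ ≤ P i l - P i j) (a : Fin k) :
    ∑ b, Real.exp (tilt Δ i j l a b) * P a b ≤ 1 := by
  have hsum := Matrix.sum_row_of_mem_rowStochastic hP
  have hnn : ∀ a b, 0 ≤ P a b := fun a b => Matrix.nonneg_of_mem_rowStochastic hP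
  by_cases ha : a = i
  · subst ha
    have hΔ1 : Δ ≤ 1 := by
      have : P a l ≤ 1 := Matrix.le_one_of_mem_rowStochastic hP
      linarith [hnn a j]
    have hexp : ∀ b, Real.exp (Δ / 2 * ((if b = j then 1 else 0) - (if b = l then 1 else 0)))
        ≤ 1 + (Δ ^ 2 / 4 + Δ / 2) * (if b = j then 1 else 0)
          + (Δ ^ 2 / 4 - Δ / 2) * (if b = l then 1 else 0) := by
      intro b
      have hq : ∀ y : ℝ, |y| ≤ 1 → Real.exp y ≤ 1 + y + y ^ 2 := fun y hy => by
        linarith [(abs_le.1 (Real.abs_exp_sub_one_sub_id_le hy)).2]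
      have hp := hq (Δ / 2) (by rw [abs_of_pos (by linarith)]; linarith)
      have hm := hq (-(Δ / 2)) (by rw [abs_neg, abs_of_pos (by linarith)]; linarith)
      by_cases hj : b = j
      · have hl : b ≠ l := fun h => hjl (hj.symm.trans h)
        simp only [if_pos hj, if_neg hl, sub_zero, mul_one, mul_zero, add_zero]
        linarith
      · by_cases hl : b = l
        · simp only [if_neg hj, if_pos hl, zero_sub, mul_one, mul_zero, add_zero, mul_neg]
          linarith
        · simp [if_neg hj, if_neg hl]
    have htilt : ∀ b, Real.exp (tilt Δ a j l a b) = Real.exp (Δ ^ 2 / 4) *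
        Real.exp (Δ / 2 * ((if b = j then 1 else 0) - (if b = l then 1 else 0))) := by
      intro b
      rw [← Real.exp_add]
      simp [tilt]
    have h1 : ∑ b, Real.exp (Δ / 2 * ((if b = j then 1 else 0) - (if b = l then 1 else 0)))
        * P a b ≤ 1 - Δ ^ 2 / 4 := by
      have h2 : P a j + P a l ≤ 1 := by
        rw [← hsum a, ← Finset.sum_pair hjl]
        exact Finset.sum_le_sum_of_subset_of_nonneg (Finset.subset_univ _) fun b _ _ => hnn a b
      calc _ ≤ ∑ b, (P a b + (Δ ^ 2 / 4 + Δ / 2) * (if b = j then P a b else 0)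
          + (Δ ^ 2 / 4 - Δ / 2) * (if b = l then P a b else 0)) := by
            refine Finset.sum_le_sum fun b _ => ?_
            refine (mul_le_mul_of_nonneg_right (hexp b) (hnn a b)).trans (le_of_eq ?_)
            split_ifs <;> ring
        _ = 1 + (Δ ^ 2 / 4 + Δ / 2) * P a j + (Δ ^ 2 / 4 - Δ / 2) * P a l := by
            rw [Finset.sum_add_distrib, Finset.sum_add_distrib, hsum, ← Finset.mul_sum,
              ← Finset.mul_sum, Finset.sum_ite_eq', Finset.sum_ite_eq']
            simp
        _ ≤ _ := by nlinarith
    have h3 : 1 - Δ ^ 2 / 4 ≤ Real.exp (-(Δ ^ 2 / 4)) := by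
      linarith [Real.add_one_le_exp (-(Δ ^ 2 / 4))]
    simp only [htilt, mul_assoc]
    rw [← Finset.mul_sum]
    refine (mul_le_mul_of_nonneg_left (h1.trans h3) (Real.exp_nonneg _)).trans (le_of_eq ?_)
    rw [← Real.exp_add, add_neg_cancel, Real.exp_zero]
  · have : ∀ b, tilt Δ i j l a b = 0 := fun b => by simp [tilt, ha]
    simp only [this, Real.exp_zero, one_mul]
    exact (hsum a).le

end Counts

/-! ### Tail bounds for the counts -/

section Tails
variable {Ω : Type*} [MeasurableSpace Ω] {Pr : Measure Ω} [IsProbabilityMeasure Pr] {k n T : ℕ}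
  {μ π : Fin k → ℝ} {P : Matrix (Fin k) (Fin k) ℝ} {X : Fin n → Fin (T + 1) → Ω → Fin k}

/-- If `i` was visited often, then the counts of two successors are rarely in the wrong order. -/
theorem measureReal_wrong_order_le (hX : IsContextSample Pr μ P X)
    (hP : P ∈ Matrix.rowStochastic ℝ (Fin k)) (hμ : ∀ j, 0 ≤ μ j) (hμ1 : ∑ j, μ j = 1)
    {Δ : ℝ} (hΔ : 0 < Δ) {i j l : Fin k} (hjl : j ≠ l) (hmargin : Δ ≤ P i l - P i j) (s : ℝ) :
    Pr.real {ω | transitionCount (fun ℓ t => X ℓ t ω) i l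
          ≤ transitionCount (fun ℓ t => X ℓ t ω) i j
        ∧ s ≤ visitCount (fun ℓ t => X ℓ t ω) i} ≤ Real.exp (-(Δ ^ 2 / 4 * s)) := by
  refine (measureReal_le_of_transition_weight hX hP hμ
    (f := fun a b => Real.exp (tilt Δ i j l a b)) (fun a b => Real.exp_nonneg _)
    (Real.exp_nonneg (-(Δ ^ 2 / 4 * s))) ?_).trans ?_
  · rintro ω ⟨h1, h2⟩
    rw [prod_exp_tilt (fun ℓ t => X ℓ t ω), ← Real.exp_add, Real.one_le_exp_iff]
    have h3 : (transitionCount (fun ℓ t => X ℓ t ω) i l : ℝ)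
        ≤ transitionCount (fun ℓ t => X ℓ t ω) i j := by exact_mod_cast h1
    have h4 := mul_le_mul_of_nonneg_left h2 (by positivity : 0 ≤ Δ ^ 2 / 4)
    have h5 := mul_nonneg (by positivity : 0 ≤ Δ / 2) (sub_nonneg.2 h3)
    linarith
  · have hnn : ∀ a b, 0 ≤ (Matrix.of fun a b => Real.exp (tilt Δ i j l a b) * P a b :
        Matrix (Fin k) (Fin k) ℝ) a b := fun a b =>
      mul_nonneg (Real.exp_nonneg _) (Matrix.nonneg_of_mem_rowStochastic hP)
    refine mul_le_of_le_one_right (Real.exp_nonneg _) (pow_le_one₀ ?_ ?_)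
    · rw [← sum_path_weight]
      exact Finset.sum_nonneg fun x _ => mul_nonneg (hμ _) (Finset.prod_nonneg fun t _ => hnn _ _)
    · rw [← hμ1]
      exact sum_vecMul_pow_le hnn (sum_exp_tilt_mul_le_one hP hΔ hjl hmargin) hμ T

/-- Lower tail of the number of visits: the mean number is at least `n T π i r`, and half of it is
rarely missed. -/
theorem measureReal_visitCount_le (hX : IsContextSample Pr μ P X) (hT : 1 ≤ T)
    (hP : P ∈ Matrix.rowStochastic ℝ (Fin k)) (hs : Matrix.vecMul π P = π)
    (hπ : ∀ i, 0 < π i) (hπ1 : ∑ i, π i = 1) (hμ : ∀ j, 0 ≤ μ j) (hμ1 : ∑ j, μ j = 1)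
    (hγ : 0 < pseudoSpectralGap π P) (hmin : 0 < minEntry π)
    (hr : 0 < coverageFactor T P μ π) (i : Fin k) :
    Pr.real {ω | (visitCount (fun ℓ t => X ℓ t ω) i : ℝ)
        ≤ n * (T * π i * coverageFactor T P μ π / 2)}
      ≤ Real.exp (-(n * (T * π i * pseudoSpectralGap π P * coverageFactor T P μ π ^ 2 / 208))) := by
  obtain ⟨m, hm, hgap⟩ := exists_spectralGap_eq hγ
  set γ := pseudoSpectralGap π P with hγdef
  set r := coverageFactor T P μ π with hrdef
  have hT0 : (0 : ℝ) < T := by exact_mod_cast hT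
  have hγ1 : γ ≤ 1 := by
    have h2 : (m : ℝ) * γ ≤ 1 := hgap ▸ spectralGap_le_one _
    have h3 : (1 : ℝ) ≤ m := by exact_mod_cast hm
    nlinarith
  have hπi := hπ i
  have hmini : minEntry π ≤ π i := ciInf_le (Set.finite_range π).bddBelow i
  have hchi : chiNorm π (μ - π) = (1 - r) * (T * minEntry π * γ) := by
    have h1 : √(chiSq μ π) = chiNorm π (μ - π) := by
      rw [← Real.sqrt_sq (chiNorm_nonneg (π := π) (μ - π)), chiNorm_sq hπ]
      rfl
    rw [hrdef, coverageFactor, ← hγdef, h1, sub_sub_cancel, div_mul_cancel₀]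
    positivity
  have hr1 : r ≤ 1 := by
    have h1 : 0 ≤ (1 - r) * (T * minEntry π * γ) := hchi ▸ chiNorm_nonneg _
    have := nonneg_of_mul_nonneg_left h1 (by positivity)
    linarith
  -- the Chernoff parameter that balances `ε r` against `ε ^ 2 / γ`
  set ε := γ * r / 52 with hε
  have hε0 : 0 < ε := by positivity
  have hγr : γ * r ≤ γ := mul_le_of_le_one_right hγ.le hr1
  have hmass := sum_vecMul_damped_pow_le hπ hπ1 hP hs hm hγ hgap hε0 (by linarith) i hμ hμ1 T
  have hmass' : ∑ j, Matrix.vecMul μ (damped P ε i ^ T) j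
      ≤ Real.exp (T * π i * (-(ε * r) + 12 * ε ^ 2 / γ)) := by
    refine hmass.trans (Real.exp_le_exp.2 ?_)
    have h1 : ε * (1 / γ + 8 * ε / γ ^ 2) * chiNorm π (μ - π)
        = ε * (1 - r) * T * minEntry π + (1 - r) * (8 * ε ^ 2 / γ * T * minEntry π) := by
      rw [hchi]
      field_simp
    have h2 : ε * (1 - r) * T * minEntry π ≤ ε * (1 - r) * T * π i :=
      mul_le_mul_of_nonneg_left hmini (by
        have : 0 ≤ 1 - r := by linarith
        positivity)
    have h3 : (1 - r) * (8 * ε ^ 2 / γ * T * minEntry π) ≤ 8 * ε ^ 2 / γ * T * π i :=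
      (mul_le_of_le_one_left (by positivity) (by linarith)).trans
        (mul_le_mul_of_nonneg_left hmini (by positivity))
    rw [h1]
    have h4 : (T : ℝ) * π i * (-(ε * r) + 12 * ε ^ 2 / γ)
        = T * (-(ε * π i) + 4 * ε ^ 2 * π i / γ) + ε * (1 - r) * T * π i
          + 8 * ε ^ 2 / γ * T * π i := by ring
    linarith
  let s : ℝ := n * (T * π i * r / 2)
  have hε1 : ε ≤ 1 / 2 := by linarith
  -- `1 / (1 - ε) ≤ 1 + ε + 2 * ε ^ 2` for `ε ≤ 1 / 2`
  have hlow : Real.exp (-(ε + 2 * ε ^ 2)) ≤ 1 - ε := by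
    rw [Real.exp_neg, inv_le_comm₀ (Real.exp_pos _) (by linarith)]
    refine le_trans ?_ (Real.add_one_le_exp _)
    rw [inv_le_iff_one_le_mul₀ (by linarith)]
    nlinarith
  have hnn : 0 ≤ ∑ j, Matrix.vecMul μ (damped P ε i ^ T) j :=
    Finset.sum_nonneg fun j _ => vecMul_damped_pow_nonneg hP (by linarith) i hμ T j
  refine (measureReal_le_of_transition_weight hX hP hμ
    (f := fun a _ => if a = i then 1 - ε else 1) (fun a b => ?_)
    (Real.exp_nonneg ((ε + 2 * ε ^ 2) * s)) ?_).trans ?_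
  · split_ifs
    · linarith
    · exact zero_le_one
  · intro ω hω
    rw [prod_damping (fun ℓ t => X ℓ t ω)]
    have h1 := pow_le_pow_left₀ (Real.exp_nonneg _) hlow (visitCount (fun ℓ t => X ℓ t ω) i)
    rw [← Real.exp_nat_mul] at h1
    refine le_trans ?_ (mul_le_mul_of_nonneg_left h1 (Real.exp_nonneg _))
    rw [← Real.exp_add, Real.one_le_exp_iff]
    have h2 : (visitCount (fun ℓ t => X ℓ t ω) i : ℝ) ≤ s := hω
    have h3 := mul_le_mul_of_nonneg_left h2 (by positivity : 0 ≤ ε + 2 * ε ^ 2)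
    linarith
  · have h1 := pow_le_pow_left₀ hnn hmass' n
    refine (mul_le_mul_of_nonneg_left h1 (Real.exp_nonneg _)).trans ?_
    rw [← Real.exp_nat_mul, ← Real.exp_add, Real.exp_le_exp]
    have h2 : (ε + 2 * ε ^ 2) * s + n * (T * π i * (-(ε * r) + 12 * ε ^ 2 / γ))
        = n * (T * π i *
          (-(γ * r ^ 2 / 104) + (γ * r) ^ 2 / 2704 * r + 12 * γ * r ^ 2 / 2704)) := by
      simp only [s, hε]
      field_simp
      ring
    rw [h2]
    have h3 : (γ * r) ^ 2 / 2704 * r ≤ γ * r ^ 2 / 2704 := by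
      have : γ * r ≤ 1 := hγr.trans hγ1
      have h5 : 0 ≤ γ * r ^ 2 / 2704 := by positivity
      nlinarith
    have h4 : (-(γ * r ^ 2 / 104) + (γ * r) ^ 2 / 2704 * r + 12 * γ * r ^ 2 / 2704)
        ≤ -(γ * r ^ 2 / 208) := by linarith
    have h5 := mul_le_mul_of_nonneg_left h4 (by positivity : 0 ≤ n * (T * π i))
    linarith

end Tails

/-! ### Correctness of count-and-argmax -/

theorem cotCorrect_of_forall_lt {k n T : ℕ} {P : Matrix (Fin k) (Fin k) ℝ} {I : Fin k → Fin k}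
    (hI : ∀ i, IsArgmax ((P ^ T) i) (I^[T] i)) {x : Fin n → Fin (T + 1) → Fin k}
    (hx : ∀ i j, j ≠ I i → transitionCount x i j < transitionCount x i (I i)) :
    CoTCorrect (P ^ T) x := by
  intro h hh
  have : h = I := by
    funext i
    by_contra hne
    exact absurd (hh i (I i)) (not_le.2 (hx i (h i) hne))
  rw [this]
  exact hI

theorem one_sub_le_measureReal_cotCorrect {Ω : Type*} [MeasurableSpace Ω] {Pr : Measure Ω}
    [IsProbabilityMeasure Pr] {k n T : ℕ} {μ π : Fin k → ℝ} {P : Matrix (Fin k) (Fin k) ℝ}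
    {X : Fin n → Fin (T + 1) → Ω → Fin k} {Δ δ : ℝ} {I : Fin k → Fin k} (hT : 1 ≤ T)
    (hI : HomogeneousInstance T P μ π Δ I) (hr : 0 < coverageFactor T P μ π)
    (hδ : 0 < δ) (hδ1 : δ < 1) (hX : IsContextSample Pr μ P X)
    (hn : 416 * (1 / (T * minEntry π * Δ ^ 2 * coverageFactor T P μ π)
        + 1 / (pseudoSpectralGap π P * T * minEntry π ^ 2 * coverageFactor T P μ π ^ 2))
      * Real.log (k / δ) ≤ n) :
    1 - δ ≤ Pr.real {ω | CoTCorrect (P ^ T) fun ℓ t => X ℓ t ω} := by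
  set γ := pseudoSpectralGap π P with hγ
  set r := coverageFactor T P μ π with hrdef
  set L := Real.log (k / δ) with hL
  have hγ0 : 0 < γ := hI.gap_pos
  have hT0 : (0 : ℝ) < T := by exact_mod_cast hT
  have hmin := hI.law_pos
  have hΔ := hI.margin_pos
  have hmini : ∀ i, minEntry π ≤ π i := fun i => ciInf_le (Set.finite_range π).bddBelow i
  have hπ : ∀ i, 0 < π i := fun i => hmin.trans_le (hmini i)
  have hk : 1 ≤ k := by
    rcases Nat.eq_zero_or_pos k with rfl | h
    · simpa using hI.law.2
    · exact h
  have hk1 : (1 : ℝ) ≤ k := by exact_mod_cast hk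
  have hL0 : 0 ≤ L := Real.log_nonneg (by rw [le_div_iff₀ hδ]; linarith)
  -- the two halves of the sample size assumption
  have hn1 : 416 * L ≤ n * (T * minEntry π * Δ ^ 2 * r) := by
    rw [← div_le_iff₀ (by positivity)]
    refine le_trans ?_ hn
    have : 0 ≤ 1 / (γ * T * minEntry π ^ 2 * r ^ 2) * L := by positivity
    rw [div_eq_mul_one_div]
    nlinarith
  have hn2 : 416 * L ≤ n * (γ * T * minEntry π ^ 2 * r ^ 2) := by
    rw [← div_le_iff₀ (by positivity)]
    refine le_trans ?_ hn
    have : 0 ≤ 1 / (T * minEntry π * Δ ^ 2 * r) * L := by positivity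
    rw [div_eq_mul_one_div]
    nlinarith
  let s : Fin k → ℝ := fun i => n * (T * π i * r / 2)
  let bad : Fin k × Fin k → Set Ω := fun p =>
    if p.2 = I p.1 then {ω | (visitCount (fun ℓ t => X ℓ t ω) p.1 : ℝ) ≤ s p.1}
    else {ω | transitionCount (fun ℓ t => X ℓ t ω) p.1 (I p.1)
          ≤ transitionCount (fun ℓ t => X ℓ t ω) p.1 p.2
        ∧ s p.1 ≤ visitCount (fun ℓ t => X ℓ t ω) p.1}
  have hbad : ∀ p, Pr.real (bad p) ≤ Real.exp (-(2 * L)) := by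
    rintro ⟨i, j⟩
    by_cases hj : j = I i
    · simp only [bad, if_pos hj]
      refine (measureReal_visitCount_le hX hT hI.kernel hI.stationary hπ hI.law.2 hI.input.1
        hI.input.2 hγ0 hmin hr i).trans (Real.exp_le_exp.2 (neg_le_neg ?_))
      have h1 : minEntry π ^ 2 ≤ π i := by
        have h2 : π i ≤ 1 :=
          hI.law.2 ▸ Finset.single_le_sum (fun j _ => (hπ j).le) (Finset.mem_univ i)
        nlinarith [hmini i]
      have h3 := mul_le_mul_of_nonneg_left h1 (by positivity : 0 ≤ n * (γ * T * r ^ 2))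
      linarith
    · simp only [bad, if_neg hj]
      refine (measureReal_wrong_order_le hX hI.kernel hI.input.1 hI.input.2 hΔ hj
        (hI.margin i j hj) (s i)).trans (Real.exp_le_exp.2 (neg_le_neg ?_))
      have h3 := mul_le_mul_of_nonneg_left (hmini i) (by positivity : 0 ≤ n * (T * Δ ^ 2 * r))
      simp only [s]
      linarith
  have hcover : {ω | CoTCorrect (P ^ T) fun ℓ t => X ℓ t ω}ᶜ ⊆ ⋃ p, bad p := by
    intro ω hω
    by_contra hno
    rw [Set.mem_iUnion, not_exists] at hno
    refine hω (cotCorrect_of_forall_lt hI.consistent fun i j hj => ?_)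
    have h1 := hno (i, I i)
    have h2 := hno (i, j)
    simp only [bad, if_true, if_neg hj, Set.mem_ofPred_eq, not_le, not_and] at h1 h2
    by_contra h3
    exact absurd (h2 (not_lt.1 h3)) (not_lt.2 h1.le)
  have hcompl : Pr.real {ω | CoTCorrect (P ^ T) fun ℓ t => X ℓ t ω}ᶜ ≤ δ := by
    refine (measureReal_mono hcover).trans ((measureReal_iUnion_fintype_le bad).trans ?_)
    refine (Finset.sum_le_card_nsmul _ _ _ fun p _ => hbad p).trans ?_
    have h1 : Real.exp (-(2 * L)) = (δ / k) ^ 2 := by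
      rw [show -(2 * L) = (2 : ℕ) * (-L) by push_cast; ring, Real.exp_nat_mul, hL, ← Real.log_inv,
        inv_div, Real.exp_log (by positivity)]
    rw [h1, Finset.card_univ, Fintype.card_prod, Fintype.card_fin, nsmul_eq_mul]
    push_cast
    have h2 : (k : ℝ) * k * (δ / k) ^ 2 = δ ^ 2 := by
      field_simp
    rw [h2]
    nlinarith
  have htot : (1 : ℝ) ≤ Pr.real {ω | CoTCorrect (P ^ T) fun ℓ t => X ℓ t ω}
      + Pr.real {ω | CoTCorrect (P ^ T) fun ℓ t => X ℓ t ω}ᶜ := by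
    refine le_trans (le_of_eq ?_) (measureReal_union_le _ _)
    rw [Set.union_compl_self, probReal_univ]
  linarith

end

theorem theorem2 :
    -- the sample size of the theorem, the implied constant depending on the gap `γ` only
    (∀ γ : ℝ, 0 < γ → ∃ C : ℝ, 0 < C ∧
      ∀ (k T n : ℕ) (P : Matrix (Fin k) (Fin k) ℝ) (μ π : Fin k → ℝ) (Δ δ r : ℝ)
        (I : Fin k → Fin k) (Ω : Type*) [MeasurableSpace Ω] (Pr : Measure Ω)
        [IsProbabilityMeasure Pr] (X : Fin n → Fin (T + 1) → Ω → Fin k),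
        1 ≤ T → HomogeneousInstance T P μ π Δ I → pseudoSpectralGap π P = γ →
        r = coverageFactor T P μ π → 0 < r → 0 < δ → δ < 1 →
        IsContextSample Pr μ P X →
        C * (1 / (T * minEntry π * Δ ^ 2 * r) + 1 / (T * minEntry π ^ 2 * r ^ 2))
          * Real.log (k / δ) ≤ n →
        1 - δ ≤ Pr.real {ω | CoTCorrect (P ^ T) fun ℓ t => X ℓ t ω}) ∧
    -- the same with an absolute constant, the dependence on `γ` being explicit
    (∃ C : ℝ, 0 < C ∧
      ∀ (k T n : ℕ) (P : Matrix (Fin k) (Fin k) ℝ) (μ π : Fin k → ℝ) (Δ δ r γ : ℝ)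
        (I : Fin k → Fin k) (Ω : Type*) [MeasurableSpace Ω] (Pr : Measure Ω)
        [IsProbabilityMeasure Pr] (X : Fin n → Fin (T + 1) → Ω → Fin k),
        1 ≤ T → HomogeneousInstance T P μ π Δ I → pseudoSpectralGap π P = γ →
        r = coverageFactor T P μ π → 0 < r → 0 < δ → δ < 1 →
        IsContextSample Pr μ P X →
        C * (1 / (T * minEntry π * Δ ^ 2 * r) + 1 / (γ * T * minEntry π ^ 2 * r ^ 2))
          * Real.log (k / δ) ≤ n →
        1 - δ ≤ Pr.real {ω | CoTCorrect (P ^ T) fun ℓ t => X ℓ t ω}) := by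
  refine ⟨fun γ hγ => ⟨416 * (1 + 1 / γ), by positivity, ?_⟩, 416, by norm_num, ?_⟩
  · intro k T n P μ π Δ δ r I Ω _ Pr _ X hT hI hgap hr hr0 hδ hδ1 hX hn
    subst hr
    refine one_sub_le_measureReal_cotCorrect hT hI hr0 hδ hδ1 hX (le_trans ?_ hn)
    rw [hgap]
    have hk1 : (1 : ℝ) ≤ k := by
      rcases Nat.eq_zero_or_pos k with rfl | h
      · simpa using hI.law.2
      · exact_mod_cast h
    refine mul_le_mul_of_nonneg_right ?_ (Real.log_nonneg (by rw [le_div_iff₀ hδ]; linarith))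
    rw [mul_assoc 416 (1 + 1 / γ)]
    refine mul_le_mul_of_nonneg_left ?_ (by norm_num : (0 : ℝ) ≤ 416)
    have hmin := hI.law_pos
    have hΔ := hI.margin_pos
    have hA : 0 ≤ 1 / (T * minEntry π * Δ ^ 2 * coverageFactor T P μ π) := by positivity
    have hB : 0 ≤ 1 / (T * minEntry π ^ 2 * coverageFactor T P μ π ^ 2) := by positivity
    have hγ' : 0 ≤ 1 / γ := by positivity
    have hsplit : 1 / (γ * T * minEntry π ^ 2 * coverageFactor T P μ π ^ 2)
        = 1 / γ * (1 / (T * minEntry π ^ 2 * coverageFactor T P μ π ^ 2)) := by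
      rw [one_div_mul_one_div]
      ring_nf
    rw [hsplit]
    nlinarith [mul_nonneg hγ' hA]
  · intro k T n P μ π Δ δ r γ I Ω _ Pr _ X hT hI hgap hr hr0 hδ hδ1 hX hn
    subst hr
    subst hgap
    exact one_sub_le_measureReal_cotCorrect hT hI hr0 hδ hδ1 hX hn
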